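/- Let $\mathbb{Z}_{\max}=\mathbb{Z}\cup\{-\infty\}$ be the semifield of tropical integers, whose addition is $\max$ and whose multiplication is $+$ (so its zero is $-\infty$ and its one is the integer $0$), and let $M_3(\mathbb{Z}_{\max})$ be the monoid of all $3\times 3$ matrices over $\mathbb{Z}_{\max}$ under matrix multiplication. Define \[ A=\begin{pmatrix}-\infty&1&-\infty\\0&-\infty&-\infty\\-\infty&-\infty&0\end{pmatrix},\quad B=\begin{pmatrix}-\infty&-1&-\infty\\-\infty&-\infty&0\\0&-\infty&-\infty\end{pmatrix}, \] \[ E_{12}=\begin{pmatrix}0&0&-\infty\\-\infty&0&-\infty\\-\infty&-\infty&0\end{pmatrix},\quad A_1(-\infty)=\begin{pmatrix}-\infty&-\infty&-\infty\\-\infty&0&-\infty\\-\infty&-\infty&0\end{pmatrix}, \] and, for $i\in\mathbb{N}_0=\{0,1,2,\dots\}$, \[ X_i=\begin{pmatrix}-\infty&0&i\\0&-\infty&0\\0&0&-\infty\end{pmatrix}. \] Here $A=A_1(1)\,P_{(1,2)}$ and $B=A_1(-1)\,P_{(1,2,3)}$, where $A_1(\lambda)$ is the diagonal matrix with diagonal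 entries $\lambda,0,0$, and $P_\sigma$ is the permutation matrix with entry $0$ in the positions $(i,\sigma(i))$ and $-\infty$ elsewhere. Let $\mathcal{X}=\{A,B,E_{12},A_1(-\infty)\}\cup\{X_i : i\in\mathbb{N}_0\}$. Call a subset $\mathcal{Y}$ of $M_3(\mathbb{Z}_{\max})$ a generating set if every element of $M_3(\mathbb{Z}_{\max})$ is a product $y_1\cdots y_m$ with $m\ge 1$ and $y_1,\dots,y_m\in \mathcal{Y}$. Then: 1. $\mathcal{X}$ is a generating set, and it is minimal: $|\mathcal{X}|\le|\mathcal{Y}|$ for every generating set $\mathcal{Y}$; 2. $\mathcal{X}$ is irredundant: for every $x\in \mathcal{X}$, the set $\mathcal{X}\setminus\{x\}$ is not a generating set; 3. $\mathcal{X}$ is countable, and every $X_i$ is prime, that is, $X_i$ is not a unit, and whenever $X_i=UV$ with $U,V\in M_3(\mathbb{Z}_{\max})$, exactly one of $U$ and $V$ is a unit. -/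

import Mathlib

namespace TropicalGen

/-! ### Generating sets and primes -/

/-- `X` is a semigroup generating set of `M`: every element of `M` is a product of a nonempty finite
sequence of elements of `X`. -/
def IsGenSet {M : Type*} [Mul M] (X : Set M) : Prop :=
  Subsemigroup.closure X = ⊤

/-- `X` is a generating set whose cardinality is at most that of any other generating set. -/
def IsMinimalGenSet {M : Type*} [Mul M] (X : Set M) : Prop :=
  IsGenSet X ∧ ∀ Y : Set M, IsGenSet Y → Cardinal.mk X ≤ Cardinal.mk Y

/-- `X` is a generating set that stops generating when any one of its elements is removed. -/
def IsIrredundantGenSet {M : Type*} [Mul M] (X : Set M) : Prop :=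
  IsGenSet X ∧ ∀ x ∈ X, ¬ IsGenSet (X \ {x})

/-- A prime element of a (noncommutative) monoid: a non-unit `x` such that in every factorisation
`x = u * v` exactly one of `u`, `v` is a unit. -/
def IsPrimeElement {M : Type*} [Monoid M] (x : M) : Prop :=
  ¬ IsUnit x ∧ ∀ u v : M, x = u * v → (IsUnit u ∧ ¬ IsUnit v) ∨ (IsUnit v ∧ ¬ IsUnit u)

/-! ### The tropical integers -/

/-- `WithBot ℤ` with the reversed order; its top element is `-∞`, which is absorbing for `+`. -/
instance instDualWithBotInt : LinearOrderedAddCommMonoidWithTop (WithBot ℤ)ᵒᵈ where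
  add_le_add_left := fun _ _ h c =>
    add_le_add_left (α := WithBot ℤ) (OrderDual.ofDual_le_ofDual.mpr h) (OrderDual.ofDual c)
  top_add' := fun x => WithBot.bot_add (OrderDual.ofDual x)
  isAddLeftRegular_of_ne_top := fun x hx _ _ h =>
    (WithBot.add_left_inj (x := OrderDual.ofDual x) hx).1 h

/-- The tropical integers `ℤ ∪ {-∞}`, with `max` as semiring addition and `+` as semiring
multiplication. Mathlib's `Tropical` takes minima, so the order of `WithBot ℤ` is reversed. -/
abbrev ZMax : Type := Tropical (WithBot ℤ)ᵒᵈ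

namespace ZMax

/-- An element of `ℤ ∪ {-∞}` seen as a tropical integer. -/
def of (a : WithBot ℤ) : ZMax := Tropical.trop (OrderDual.toDual a)

/-- The tropical integer `-∞`. -/
def negInf : ZMax := of ⊥

/-- The integer `a` as a tropical integer (not to be confused with the numeral casts of the semiring
`ZMax`, for which `0` is `-∞` and `1` is the integer `0`). -/
def int (a : ℤ) : ZMax := of (a : WithBot ℤ)

theorem of_bijective : Function.Bijective of :=
  ⟨fun _ _ h => OrderDual.toDual.injective (Tropical.trop_injective h), fun a => ⟨OrderDual.ofDual (Tropical.untrop a), rfl⟩⟩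

theorem of_add_of (a b : WithBot ℤ) : of a + of b = of (max a b) := rfl

theorem of_mul_of (a b : WithBot ℤ) : of a * of b = of (a + b) := rfl

theorem zero_eq : (0 : ZMax) = negInf := rfl

theorem one_eq : (1 : ZMax) = int 0 := rfl

end ZMax

/-! ### Matrices -/

/-- `A_i(c)`: the diagonal matrix with `c` in position `(i, i)` and `1` elsewhere on the diagonal. -/
def diagAt {S : Type*} [CommSemiring S] {n : ℕ} (i : Fin n) (c : S) : Matrix (Fin n) (Fin n) S :=
  Matrix.diagonal (Function.update 1 i c)

/-- `E_{ij}(c)` (for `i ≠ j`): `1` on the diagonal, `c` in position `(i, j)` and `0` elsewhere. -/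
def elemAt {S : Type*} [CommSemiring S] {n : ℕ} (i j : Fin n) (c : S) : Matrix (Fin n) (Fin n) S :=
  Matrix.of fun k l => if k = l then 1 else if k = i ∧ l = j then c else 0

/-- The monoid `M_3(ℤ_max)`. -/
abbrev M3 : Type := Matrix (Fin 3) (Fin 3) ZMax

/-- `A = A_1(1) P_{(1,2)}`; indices are shifted to `0, 1, 2`, and the permutation matrix of `σ` has
its `1`s in the positions `(i, σ i)`. -/
def matA : M3 := diagAt 0 (ZMax.int 1) * (Equiv.swap (0 : Fin 3) 1).permMatrix ZMax

/-- `B = A_1(-1) P_{(1,2,3)}`; `finRotate 3` is the cycle `0 ↦ 1 ↦ 2 ↦ 0`. -/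
def matB : M3 := diagAt 0 (ZMax.int (-1)) * (finRotate 3).permMatrix ZMax

/-- `E_{12} = E_{12}(1_S)`, where `1_S` is the integer `0`. -/
def matE : M3 := elemAt 0 1 1

/-- `A_1(-∞)`. -/
def matC : M3 := diagAt 0 ZMax.negInf

/-- The matrices `X_i`, for `i` a natural number (including `0`). -/
def matX (i : ℕ) : M3 :=
  !![ZMax.negInf, ZMax.int 0,  ZMax.int i;
     ZMax.int 0,  ZMax.negInf, ZMax.int 0;
     ZMax.int 0,  ZMax.int 0,  ZMax.negInf]

/-- The set of the matrices `A`, `B`, `E_{12}`, `A_1(-∞)` and all the `X_i`. -/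
def generators : Set M3 := {matA, matB, matE, matC} ∪ Set.range matX

end TropicalGen

/-!
The nonzero entries of a tropical matrix multiply like a Boolean matrix (`mul_apply_ne_zero`),
because `ZMax` has no zero divisors and its sums never cancel. Most of the argument only uses
these supports. In particular a one-sided invertible matrix is monomial
(`isMonomial_of_mul_eq_one`), so the units are the monomial matrices and a product is a unit only
if both factors are.

*Generation.* `matA` and `matB` generate all monomial matrices, which reduces the question to
matrices up to scaling and permuting rows and columns. If the support of a nonzero column is
contained in that of another column, an elementary matrix splits off and the number of nonzero
entries drops (`exists_eq_mul_elemAt`); the same holds for rows. The supports at which this stops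
are the partial permutations, which give a diagonal matrix times a permutation matrix, and the
complements of permutations (`support_cases`). In the latter case the matrix can be scaled to one
of the `matX i` (`mem_of_hollow`), the number `i` being the difference of the weights of the two
`3`-cycles.

*Minimality.* The complement of the identity is a prime Boolean matrix (`bool_hollow_factor`),
hence every `matX i` is prime, and every generating set contains an associate of it.
Multiplication by units shifts and permutes the terms of the tropical permanent
(`exists_permWeight_eq`); for `matX i` the finite terms are `0` and `i`, so different `matX i` are
not associated. Thus every generating set is infinite, while `generators` is countable.

*Irredundance.* Primality settles `matX i`. Without `matA` the only generated units are powers of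
`matB`, with which `matA` does not commute, and vice versa. Without `matC` no generated matrix has
a zero row. For `matE` the invariant is to have exactly one permutation in the support: this
property passes from a product to its factors (`HasUniquePerm.of_mul`), and among the generators
only `matE` has it without being a unit.
-/

namespace TropicalGen

/-! ### Arithmetic of the tropical integers -/

namespace ZMax

@[simp] theorem int_mul_int (a b : ℤ) : int a * int b = int (a + b) := rfl

@[simp] theorem int_add_int (a b : ℤ) : int a + int b = int (max a b) := by
  rw [int, int, of_add_of, int, WithBot.coe_max]

@[simp] theorem int_inj {a b : ℤ} : int a = int b ↔ a = b := by
  rw [int, int, of_bijective.injective.eq_iff, WithBot.coe_inj]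

@[simp] theorem int_ne_zero (a : ℤ) : int a ≠ 0 := fun h =>
  WithBot.coe_ne_bot (of_bijective.injective h)

theorem ne_zero_iff {x : ZMax} : x ≠ 0 ↔ ∃ a, x = int a := by
  refine ⟨fun h => ?_, fun ⟨a, ha⟩ => ha ▸ int_ne_zero a⟩
  obtain ⟨y, rfl⟩ := of_bijective.surjective x
  induction y using WithBot.recBotCoe with
  | bot => exact absurd rfl h
  | coe a => exact ⟨a, rfl⟩

instance : Nontrivial ZMax := ⟨⟨int 0, 0, int_ne_zero 0⟩⟩

instance : NoZeroDivisors ZMax where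
  eq_zero_or_eq_zero_of_mul_eq_zero {x y} h := by
    by_contra! hxy
    obtain ⟨a, rfl⟩ := ne_zero_iff.1 hxy.1
    obtain ⟨b, rfl⟩ := ne_zero_iff.1 hxy.2
    exact int_ne_zero _ h

theorem add_ne_zero_iff {x y : ZMax} : x + y ≠ 0 ↔ x ≠ 0 ∨ y ≠ 0 := by
  by_cases hx : x = 0
  · simp [hx]
  by_cases hy : y = 0
  · simp [hy]
  obtain ⟨a, rfl⟩ := ne_zero_iff.1 hx
  obtain ⟨b, rfl⟩ := ne_zero_iff.1 hy
  simp

theorem sum_ne_zero_iff {ι : Type*} (s : Finset ι) (f : ι → ZMax) :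
    ∑ i ∈ s, f i ≠ 0 ↔ ∃ i ∈ s, f i ≠ 0 := by
  classical
  induction s using Finset.induction_on with
  | empty => simp
  | insert a s ha ih => rw [Finset.sum_insert ha, add_ne_zero_iff, ih]; simp

end ZMax

open ZMax Matrix

/-- Supports multiply as Boolean matrices, since `ZMax` has no zero divisors and a sum vanishes only
if all its terms do. -/
theorem mul_apply_ne_zero {ι : Type*} [Fintype ι] {M N : Matrix ι ι ZMax} {i j : ι} :
    (M * N) i j ≠ 0 ↔ ∃ k, M i k ≠ 0 ∧ N k j ≠ 0 := by
  rw [Matrix.mul_apply, sum_ne_zero_iff]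
  simp

/-! ### Units are the monomial matrices -/

/-- A monomial matrix: its nonzero entries are exactly those in the positions `(i, σ i)`, for some
permutation `σ`. -/
def IsMonomial {ι : Type*} (M : Matrix ι ι ZMax) : Prop :=
  ∃ σ : Equiv.Perm ι, ∀ i j, M i j ≠ 0 ↔ j = σ i

theorem permMatrix_mul_apply {ι : Type*} [Fintype ι] [DecidableEq ι] (σ : Equiv.Perm ι)
    (M : Matrix ι ι ZMax) (i j : ι) : (σ.permMatrix ZMax * M) i j = M (σ i) j := by
  simp [Equiv.Perm.permMatrix, PEquiv.toMatrix_toPEquiv_mul]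

theorem mul_permMatrix_apply {ι : Type*} [Fintype ι] [DecidableEq ι] (σ : Equiv.Perm ι)
    (M : Matrix ι ι ZMax) (i j : ι) : (M * σ.permMatrix ZMax) i j = M i (σ.symm j) := by
  simp [Equiv.Perm.permMatrix, PEquiv.mul_toMatrix_toPEquiv]

theorem permMatrix_apply_eq {ι : Type*} [Fintype ι] [DecidableEq ι] (σ : Equiv.Perm ι) (i j : ι) :
    σ.permMatrix ZMax i j = if j = σ i then 1 else 0 := by
  simp [Equiv.Perm.permMatrix, PEquiv.toMatrix_apply, eq_comm]

/-- A matrix supported on the graph of a permutation is a diagonal matrix times a permutation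
matrix. -/
theorem eq_diagonal_mul_permMatrix {ι : Type*} [Fintype ι] [DecidableEq ι] {M : Matrix ι ι ZMax}
    {σ : Equiv.Perm ι} (h : ∀ i j, M i j ≠ 0 → j = σ i) :
    M = diagonal (fun i => M i (σ i)) * σ.permMatrix ZMax := by
  ext i j
  rw [Matrix.diagonal_mul, permMatrix_apply_eq]
  split_ifs with hj
  · simp [hj]
  · rw [mul_zero]
    by_contra h0
    exact hj (h i j h0)

theorem isUnit_permMatrix {ι : Type*} [Fintype ι] [DecidableEq ι] (σ : Equiv.Perm ι) :
    IsUnit (σ.permMatrix ZMax) := by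
  refine ⟨⟨σ.permMatrix ZMax, σ⁻¹.permMatrix ZMax, ?_, ?_⟩, rfl⟩ <;>
  · rw [← Matrix.permMatrix_mul]
    simp

theorem isUnit_diagonal_int {ι : Type*} [Fintype ι] [DecidableEq ι] (d : ι → ℤ) :
    IsUnit (diagonal fun i => int (d i)) := by
  refine ⟨⟨diagonal fun i => int (d i), diagonal fun i => int (-d i), ?_, ?_⟩, rfl⟩ <;>
  · rw [Matrix.diagonal_mul_diagonal, ← Matrix.diagonal_one]
    simp [one_eq]

theorem IsMonomial.exists_eq {ι : Type*} [Fintype ι] [DecidableEq ι] {M : Matrix ι ι ZMax}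
    (h : IsMonomial M) : ∃ (d : ι → ℤ) (σ : Equiv.Perm ι),
      M = diagonal (fun i => int (d i)) * σ.permMatrix ZMax := by
  obtain ⟨σ, hσ⟩ := h
  choose d hd using fun i => ne_zero_iff.1 ((hσ i (σ i)).2 rfl)
  refine ⟨d, σ, ?_⟩
  simpa only [hd] using eq_diagonal_mul_permMatrix fun i j => (hσ i j).1

/-- A matrix with a right inverse is monomial: if `M i (f i)` and `N (f i) i` are nonzero for all
`i`, then every nonzero `M i (f i')` makes `(M * N) i i'` nonzero, so that `i = i'`. -/
theorem isMonomial_of_mul_eq_one {ι : Type*} [Fintype ι] [DecidableEq ι] {M N : Matrix ι ι ZMax}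
    (h : M * N = 1) : IsMonomial M := by
  have h1 : ∀ i j k, M i k ≠ 0 → N k j ≠ 0 → i = j := fun i j k hM hN => by
    by_contra hij
    exact mul_apply_ne_zero.2 ⟨k, hM, hN⟩ (by rw [h, Matrix.one_apply_ne hij])
  choose f hM hN using fun i => (mul_apply_ne_zero (M := M) (N := N) (i := i) (j := i)).1
    (by rw [h, Matrix.one_apply_eq]; exact one_ne_zero)
  have hf : Function.Injective f := fun i i' hi => h1 i i' (f i) (hM i) (hi ▸ hN i')
  refine ⟨Equiv.ofBijective f (Finite.injective_iff_bijective.1 hf), fun i j => ⟨fun hj => ?_, ?_⟩⟩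
  · obtain ⟨i', rfl⟩ := (Finite.injective_iff_surjective.1 hf) j
    rw [h1 i i' _ hj (hN i'), Equiv.ofBijective_apply]
  · rintro rfl
    exact hM i

theorem isUnit_iff_isMonomial {ι : Type*} [Fintype ι] [DecidableEq ι] {M : Matrix ι ι ZMax} :
    IsUnit M ↔ IsMonomial M := by
  refine ⟨fun ⟨u, hu⟩ => isMonomial_of_mul_eq_one (N := ↑u⁻¹) (hu ▸ u.mul_inv), fun h => ?_⟩
  obtain ⟨d, σ, rfl⟩ := h.exists_eq
  exact (isUnit_diagonal_int d).mul (isUnit_permMatrix σ)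

instance {ι : Type*} [Fintype ι] [DecidableEq ι] : IsDedekindFiniteMonoid (Matrix ι ι ZMax) where
  mul_eq_one_symm {M N} h := by
    obtain ⟨u, rfl⟩ := isUnit_iff_isMonomial.2 (isMonomial_of_mul_eq_one h)
    rw [← Units.inv_eq_of_mul_eq_one_right h, Units.inv_mul]

theorem IsMonomial.eq_of_ne_zero {ι : Type*} {M : Matrix ι ι ZMax} (h : IsMonomial M) {i j k : ι}
    (hj : M i j ≠ 0) (hk : M i k ≠ 0) : j = k := by
  obtain ⟨σ, hσ⟩ := h
  rw [(hσ i j).1 hj, (hσ i k).1 hk]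

/-! ### Generation -/

theorem matA_mem : matA ∈ generators := by simp [generators]

theorem matB_mem : matB ∈ generators := by simp [generators]

theorem matE_mem : matE ∈ generators := by simp [generators]

theorem matC_mem : matC ∈ generators := by simp [generators]

theorem matX_mem (i : ℕ) : matX i ∈ generators := by simp [generators]

/-- The subsemigroup generated by the generators under consideration. -/
def generated : Subsemigroup M3 := Subsemigroup.closure generators

theorem matA_mem_generated : matA ∈ generated := Subsemigroup.subset_closure matA_mem

theorem matB_mem_generated : matB ∈ generated := Subsemigroup.subset_closure matB_mem

/-- The words come from `matA ^ 2 = diag(1, 1, 0)` and `matB ^ 3 = diag(-1, -1, -1)`: spreading the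
three letters `matB` around `matA ^ 2` rotates the diagonal entries. -/
theorem diagAt_neg_one_mem (i : Fin 3) : diagAt i (int (-1)) ∈ generated := by
  have hA := matA_mem_generated
  have hB := matB_mem_generated
  fin_cases i
  · have h : matB * matB * matA * matA * matB = diagAt 0 (int (-1)) := by decide +kernel
    exact h ▸ mul_mem (mul_mem (mul_mem (mul_mem hB hB) hA) hA) hB
  · have h : matB * matA * matA * matB * matB = diagAt 1 (int (-1)) := by decide +kernel
    exact h ▸ mul_mem (mul_mem (mul_mem (mul_mem hB hA) hA) hB) hB
  · have h : matA * matA * matB * matB * matB = diagAt 2 (int (-1)) := by decide +kernel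
    exact h ▸ mul_mem (mul_mem (mul_mem (mul_mem hA hA) hB) hB) hB

theorem diagAt_one_mem (i : Fin 3) : diagAt i (int 1) ∈ generated := by
  have hA := matA_mem_generated
  have hB := matB_mem_generated
  fin_cases i
  · have h : matA * matA * diagAt 1 (int (-1)) = diagAt 0 (int 1) := by decide +kernel
    exact h ▸ mul_mem (mul_mem hA hA) (diagAt_neg_one_mem 1)
  · have h : matA * matA * diagAt 0 (int (-1)) = diagAt 1 (int 1) := by decide +kernel
    exact h ▸ mul_mem (mul_mem hA hA) (diagAt_neg_one_mem 0)
  · have h : matB * matA * matA * matB * matA * matA * matB = diagAt 2 (int 1) := by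
      decide +kernel
    exact h ▸ mul_mem (mul_mem (mul_mem (mul_mem (mul_mem (mul_mem hB hA) hA) hB) hA) hA) hB

theorem diagAt_mul {n : ℕ} (i : Fin n) (x y : ZMax) :
    diagAt i x * diagAt i y = diagAt i (x * y) := by
  rw [diagAt, diagAt, diagAt, Matrix.diagonal_mul_diagonal]
  congr 1
  ext j
  by_cases h : j = i
  · subst h; simp
  · simp [h]

theorem diagAt_one {n : ℕ} (i : Fin n) : diagAt i (1 : ZMax) = 1 := by
  rw [diagAt, ← Pi.one_apply (M := fun _ : Fin n => ZMax) i, Function.update_eq_self,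
    ← Matrix.diagonal_one]
  rfl

theorem one_mem_generated : (1 : M3) ∈ generated := by
  have h := mul_mem (diagAt_one_mem 0) (diagAt_neg_one_mem 0)
  rwa [diagAt_mul, int_mul_int, add_neg_cancel, ← one_eq, diagAt_one] at h

theorem diagAt_int_mem (i : Fin 3) (a : ℤ) : diagAt i (int a) ∈ generated := by
  induction a using Int.induction_on with
  | zero => rw [← one_eq, diagAt_one]; exact one_mem_generated
  | succ n ih => rw [← int_mul_int, ← diagAt_mul]; exact mul_mem ih (diagAt_one_mem i)
  | pred n ih =>
    rw [sub_eq_add_neg, ← int_mul_int, ← diagAt_mul]; exact mul_mem ih (diagAt_neg_one_mem i)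

theorem permMatrix_mem (σ : Equiv.Perm (Fin 3)) : σ.permMatrix ZMax ∈ generated := by
  have hs : (Equiv.swap (0 : Fin 3) 1).permMatrix ZMax ∈ generated := by
    have h : diagAt 0 (int (-1)) * matA = (Equiv.swap (0 : Fin 3) 1).permMatrix ZMax := by
      decide +kernel
    exact h ▸ mul_mem (diagAt_neg_one_mem 0) matA_mem_generated
  have hr : (finRotate 3).permMatrix ZMax ∈ generated := by
    have h : diagAt 0 (int 1) * matB = (finRotate 3).permMatrix ZMax := by decide +kernel
    exact h ▸ mul_mem (diagAt_one_mem 0) matB_mem_generated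
  have hpow : ∀ {τ : Equiv.Perm (Fin 3)}, τ.permMatrix ZMax ∈ generated → ∀ n : ℕ,
      (τ ^ n).permMatrix ZMax ∈ generated := fun {τ} hτ n => by
    induction n with
    | zero => simpa using one_mem_generated
    | succ n ih => rw [pow_succ, Matrix.permMatrix_mul]; exact mul_mem hτ ih
  have hσ : ∀ σ : Equiv.Perm (Fin 3), ∃ a b : Fin 3,
      σ = Equiv.swap 0 1 ^ (a : ℕ) * finRotate 3 ^ (b : ℕ) := by decide +kernel
  obtain ⟨a, b, rfl⟩ := hσ σ
  rw [Matrix.permMatrix_mul]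
  exact mul_mem (hpow hr b) (hpow hs a)

/-- Membership is invariant under permuting rows and columns. -/
theorem submatrix_mem {M : M3} (h : M ∈ generated) (σ τ : Equiv.Perm (Fin 3)) :
    M.submatrix σ τ ∈ generated := by
  have : M.submatrix σ τ = σ.permMatrix ZMax * M * Equiv.Perm.permMatrix ZMax τ.symm := by
    ext i j
    rw [mul_permMatrix_apply, permMatrix_mul_apply, Equiv.symm_symm, Matrix.submatrix_apply]
  rw [this]
  exact mul_mem (mul_mem (permMatrix_mem σ) h) (permMatrix_mem _)

theorem diagAt_mem (i : Fin 3) (x : ZMax) : diagAt i x ∈ generated := by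
  by_cases hx : x = 0
  · have h : ∀ i, diagAt i (0 : ZMax) = matC.submatrix (Equiv.swap 0 i) (Equiv.swap 0 i) := by
      decide +kernel
    rw [hx, h]
    exact submatrix_mem (Subsemigroup.subset_closure matC_mem) _ _
  · obtain ⟨a, rfl⟩ := ne_zero_iff.1 hx
    exact diagAt_int_mem i a

theorem diagonal_mem (d : Fin 3 → ZMax) : diagonal d ∈ generated := by
  have h : diagonal d = diagAt 0 (d 0) * diagAt 1 (d 1) * diagAt 2 (d 2) := by
    simp only [diagAt, Matrix.diagonal_mul_diagonal]
    congr 1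
    ext i
    fin_cases i <;> simp
  rw [h]
  exact mul_mem (mul_mem (diagAt_mem _ _) (diagAt_mem _ _)) (diagAt_mem _ _)

theorem elemAt_mem {i j : Fin 3} (hij : i ≠ j) (a : ℤ) : elemAt i j (int a) ∈ generated := by
  have h01 : elemAt 0 1 (int a) = diagAt 0 (int a) * matE * diagAt (0 : Fin 3) (int (-a)) := by
    ext k l
    rw [diagAt, diagAt, Matrix.mul_diagonal, Matrix.diagonal_mul]
    fin_cases k <;> fin_cases l <;> simp [elemAt, matE, one_eq]
  have hσ : ∀ i j : Fin 3, i ≠ j → ∃ σ : Equiv.Perm (Fin 3), σ i = 0 ∧ σ j = 1 := by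
    decide +kernel
  obtain ⟨σ, hi, hj⟩ := hσ i j hij
  have h : elemAt i j (int a) = (elemAt 0 1 (int a)).submatrix σ σ := by
    ext k l
    simp only [elemAt, Matrix.submatrix_apply, Matrix.of_apply, σ.injective.eq_iff, ← hi, ← hj]
  rw [h, h01]
  exact submatrix_mem (mul_mem (mul_mem (diagAt_mem _ _)
    (Subsemigroup.subset_closure matE_mem)) (diagAt_mem _ _)) _ _

/-- A matrix with `-∞` exactly on the diagonal can be scaled by diagonal matrices on both sides
until its only possibly nonzero finite exponent is the difference of the weights of its two
`3`-cycles. If this difference is nonnegative, the result is one of the `matX i`. -/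
theorem mem_of_hollow_of_le {M : M3} {m : Fin 3 → Fin 3 → ℤ} (hdiag : ∀ i, M i i = 0)
    (hM : ∀ i j, i ≠ j → M i j = int (m i j))
    (hle : m 0 1 + m 1 2 + m 2 0 ≤ m 0 2 + m 2 1 + m 1 0) : M ∈ generated := by
  obtain ⟨n, hn⟩ := Int.eq_ofNat_of_zero_le (sub_nonneg.2 hle)
  have h : M = diagonal ![int 0, int (m 1 0 - m 2 0 + m 2 1 - m 0 1), int (m 2 1 - m 0 1)] *
      matX n * diagonal ![int (m 2 0 - m 2 1 + m 0 1), int (m 0 1),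
        int (m 1 2 - m 1 0 + m 2 0 - m 2 1 + m 0 1)] := by
    ext i j
    rw [Matrix.mul_diagonal, Matrix.diagonal_mul]
    by_cases hij : i = j
    · subst hij
      rw [hdiag]
      fin_cases i <;> simp [matX, ← zero_eq]
    · rw [hM i j hij]
      fin_cases i <;> fin_cases j <;> first | exact absurd rfl hij | (simp [matX]; try omega)
  rw [h]
  exact mul_mem (mul_mem (diagonal_mem _) (Subsemigroup.subset_closure (matX_mem n)))
    (diagonal_mem _)

theorem mem_of_hollow {M : M3} (h : ∀ i j, M i j ≠ 0 ↔ i ≠ j) : M ∈ generated := by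
  have hdiag : ∀ i, M i i = 0 := fun i => by simpa using (h i i).not
  have hm : ∀ i j, ∃ m, i ≠ j → M i j = int m := fun i j => by
    by_cases hij : i = j
    · exact ⟨0, fun h => absurd hij h⟩
    · obtain ⟨m, hm⟩ := ne_zero_iff.1 ((h i j).2 hij)
      exact ⟨m, fun _ => hm⟩
  choose m hm using hm
  rcases le_total (m 0 1 + m 1 2 + m 2 0) (m 0 2 + m 2 1 + m 1 0) with hle | hle
  · exact mem_of_hollow_of_le hdiag hm hle
  · -- Conjugating by the transposition of `0` and `2` exchanges the two `3`-cycles.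
    have h' : M.submatrix (Equiv.swap 0 2) (Equiv.swap 0 2) ∈ generated :=
      mem_of_hollow_of_le (m := fun i j => m (Equiv.swap 0 2 i) (Equiv.swap 0 2 j))
        (fun i => hdiag _) (fun i j hij => hm _ _ fun e => hij ((Equiv.swap 0 2).injective e))
        (by
          have h1 : Equiv.swap (0 : Fin 3) 2 1 = 1 := by decide
          simp only [Equiv.swap_apply_left, Equiv.swap_apply_right, h1]
          omega)
    have h2 := submatrix_mem h' (Equiv.swap 0 2) (Equiv.swap 0 2)
    have hswap : (Equiv.swap (0 : Fin 3) 2 : Fin 3 → Fin 3) ∘ Equiv.swap 0 2 = id :=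
      (Equiv.swap (0 : Fin 3) 2).symm_comp_self
    rwa [Matrix.submatrix_submatrix, hswap, Matrix.submatrix_id_id] at h2

/-- The number of nonzero entries of a matrix. -/
def supportCard (M : M3) : ℕ := (Finset.univ.filter fun p : Fin 3 × Fin 3 => M p.1 p.2 ≠ 0).card

theorem supportCard_transpose (M : M3) : supportCard Mᵀ = supportCard M := by
  unfold supportCard
  refine Finset.card_equiv (Equiv.prodComm _ _) fun p => ?_
  rw [Finset.mem_filter, Finset.mem_filter]
  simp

theorem transpose_elemAt {n : ℕ} (i j : Fin n) (x : ZMax) : (elemAt i j x)ᵀ = elemAt j i x := by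
  ext k l
  simp [elemAt, eq_comm, and_comm]

theorem mul_elemAt_apply {M : M3} {i j : Fin 3} (hij : i ≠ j) (x : ZMax) (k l : Fin 3) :
    (M * elemAt i j x) k l = if l = j then M k j + M k i * x else M k l := by
  have h : ∀ m, M k m * elemAt i j x m l =
      (if m = l then M k m else 0) + if m = i then (if l = j then M k m * x else 0) else 0 := by
    intro m
    simp only [elemAt, Matrix.of_apply]
    by_cases h1 : m = l
    · subst h1
      by_cases h2 : m = i
      · subst h2; simp [hij]
      · simp [h2]
    · by_cases h2 : m = i
      · subst h2; by_cases h3 : l = j <;> simp [h1, h3, hij]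
      · simp [h1, h2]
  rw [Matrix.mul_apply, Finset.sum_congr rfl fun m _ => h m, Finset.sum_add_distrib]
  simp only [Finset.sum_ite_eq', Finset.mem_univ, if_true]
  split_ifs with h
  · rw [h]
  · rw [add_zero]

/-- If the support of column `i` is nonempty and contained in that of column `j`, an elementary
matrix can be split off on the right so that column `j` loses an entry. -/
theorem exists_eq_mul_elemAt {M : M3} {i j : Fin 3} (hij : i ≠ j) (hne : ∃ k, M k i ≠ 0)
    (hsub : ∀ k, M k i ≠ 0 → M k j ≠ 0) :
    ∃ (N : M3) (a : ℤ), M = N * elemAt i j (int a) ∧ supportCard N < supportCard M := by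
  have hval : ∀ k l, ∃ a, M k l ≠ 0 → M k l = int a := fun k l => by
    by_cases h : M k l = 0
    · exact ⟨0, fun h' => absurd h h'⟩
    · obtain ⟨a, ha⟩ := ne_zero_iff.1 h
      exact ⟨a, fun _ => ha⟩
  choose m hm using hval
  -- The largest multiple of column `i` below column `j` agrees with column `j` in some row `k`.
  obtain ⟨k, hk, hmin⟩ := Finset.exists_min_image (Finset.univ.filter fun k => M k i ≠ 0)
    (fun k => m k j - m k i) (by simpa [Finset.Nonempty] using hne)
  have hk : M k i ≠ 0 := by simpa using hk
  refine ⟨Matrix.of fun p q => if p = k ∧ q = j then 0 else M p q, m k j - m k i, ?_, ?_⟩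
  · ext p q
    rw [mul_elemAt_apply hij]
    simp only [Matrix.of_apply, hij, and_false, if_false]
    by_cases hq : q = j
    · subst hq
      by_cases hp : p = k
      · subst hp
        simp [hm p i hk, hm p q (hsub p hk)]
      · by_cases hpi : M p i = 0
        · simp [hp, hpi]
        · have := hmin p (by simpa using hpi)
          simp only [hp, false_and, if_false, if_true, hm p i hpi, hm p q (hsub p hpi),
            int_mul_int, int_add_int, int_inj]
          omega
    · simp [hq]
  · refine Finset.card_lt_card (Finset.ssubset_iff_of_subset ?_ |>.2 ⟨(k, j), ?_, ?_⟩)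
    · intro p
      rw [Finset.mem_filter, Finset.mem_filter, Matrix.of_apply]
      split_ifs <;> simp
    · simpa using hsub k hk
    · simp

/-- The supports to which no elementary row or column reduction applies: partial permutations, and
complements of permutations. -/
theorem support_cases : ∀ s : Fin 3 → Fin 3 → Bool,
    (∃ i j, i ≠ j ∧ (∃ k, s k i) ∧ ∀ k, s k i → s k j) ∨
    (∃ i j, i ≠ j ∧ (∃ k, s i k) ∧ ∀ k, s i k → s j k) ∨
    (∃ σ : Equiv.Perm (Fin 3), ∀ i j, s i j → j = σ i) ∨
    ∃ σ : Equiv.Perm (Fin 3), ∀ i j, s i j ↔ j ≠ σ i := by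
  decide +kernel

theorem mem_generated (M : M3) : M ∈ generated := by
  induction h : supportCard M using Nat.strong_induction_on generalizing M with
  | _ n ih =>
    subst h
    have hcases := support_cases fun i j => decide (M i j ≠ 0)
    simp only [decide_eq_true_eq] at hcases
    rcases hcases with ⟨i, j, hij, hne, hsub⟩ | ⟨i, j, hij, hne, hsub⟩ | ⟨σ, hσ⟩ | ⟨σ, hσ⟩
    · obtain ⟨N, a, hN, hlt⟩ := exists_eq_mul_elemAt hij hne hsub
      rw [hN]
      exact mul_mem (ih _ hlt N rfl) (elemAt_mem hij a)
    · obtain ⟨N, a, hN, hlt⟩ := exists_eq_mul_elemAt (M := Mᵀ) hij hne hsub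
      rw [← M.transpose_transpose, hN, Matrix.transpose_mul, transpose_elemAt]
      rw [← supportCard_transpose N, supportCard_transpose M] at hlt
      exact mul_mem (elemAt_mem hij.symm a) (ih _ hlt _ rfl)
    · rw [eq_diagonal_mul_permMatrix hσ]
      exact mul_mem (diagonal_mem _) (permMatrix_mem σ)
    · have h : M.submatrix id σ ∈ generated := mem_of_hollow fun i j => by
        rw [Matrix.submatrix_apply, hσ, id, σ.injective.ne_iff, ne_comm]
      simpa [Matrix.submatrix_submatrix] using submatrix_mem h 1 σ.symm

theorem isGenSet_generators : IsGenSet generators :=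
  Subsemigroup.ext fun M => ⟨fun _ => Subsemigroup.mem_top M, fun _ => mem_generated M⟩

/-! ### Prime elements and generating sets -/

theorem IsPrimeElement.of_isUnit_mul {M : Type*} [Monoid M] {u x : M} (hu : IsUnit u)
    (h : IsPrimeElement (u * x)) : IsPrimeElement x := by
  refine ⟨fun hx => h.1 (hu.mul hx), fun a b hab => ?_⟩
  have hua : IsUnit (u * a) ↔ IsUnit a := by
    obtain ⟨w, rfl⟩ := hu
    exact w.isUnit_units_mul a
  simpa only [hua] using h.2 (u * a) b (by rw [hab, mul_assoc])

theorem IsPrimeElement.of_mul_isUnit {M : Type*} [Monoid M] {u x : M} (hu : IsUnit u)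
    (h : IsPrimeElement (x * u)) : IsPrimeElement x := by
  refine ⟨fun hx => h.1 (hx.mul hu), fun a b hab => ?_⟩
  have hbu : IsUnit (b * u) ↔ IsUnit b := by
    obtain ⟨w, rfl⟩ := hu
    exact w.isUnit_mul_units b
  simpa only [hbu] using h.2 a (b * u) (by rw [hab, mul_assoc])

/-- A generating set contains an associate of every prime. -/
theorem IsPrimeElement.exists_eq_of_mem_closure {M : Type*} [Monoid M] {Y : Set M} {x : M}
    (hx : x ∈ Subsemigroup.closure Y) (h : IsPrimeElement x) :
    ∃ y ∈ Y, ∃ u v : Mˣ, x = u * y * v := by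
  induction hx using Subsemigroup.closure_induction with
  | mem x hx => exact ⟨x, hx, 1, 1, by simp⟩
  | mul a b _ _ iha ihb =>
    rcases h.2 a b rfl with ⟨ha, -⟩ | ⟨hb, -⟩
    · obtain ⟨y, hy, u, v, rfl⟩ := ihb (h.of_isUnit_mul ha)
      obtain ⟨w, rfl⟩ := ha
      exact ⟨y, hy, w * u, v, by simp [mul_assoc]⟩
    · obtain ⟨y, hy, u, v, rfl⟩ := iha (h.of_mul_isUnit hb)
      obtain ⟨w, rfl⟩ := hb
      exact ⟨y, hy, u, v * w, by simp [mul_assoc]⟩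

theorem not_isPrimeElement_of_isIdempotentElem {M : Type*} [Monoid M] {x : M}
    (h : IsIdempotentElem x) : ¬ IsPrimeElement x := fun hx => by
  have := hx.2 x x h.eq.symm
  tauto

/-! ### The matrices `X_i` are primes, and pairwise not associated -/

theorem matX_apply_ne_zero (n : ℕ) (i j : Fin 3) : matX n i j ≠ 0 ↔ i ≠ j := by
  fin_cases i <;> fin_cases j <;> simp [matX, ← zero_eq]

theorem not_isUnit_matX (n : ℕ) : ¬ IsUnit (matX n) := fun h => by
  have := (isUnit_iff_isMonomial.1 h).eq_of_ne_zero ((matX_apply_ne_zero n 0 1).2 (by decide))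
    ((matX_apply_ne_zero n 0 2).2 (by decide))
  exact absurd this (by decide)

set_option synthInstance.maxSize 1000 in
set_option synthInstance.maxHeartbeats 400000 in
/-- The complement of the identity is a prime Boolean matrix: in a factorisation, one of the factors
is a permutation matrix. The second factor is given by its columns `a`, `b`, `c`. -/
theorem bool_hollow_factor : ∀ u : Fin 3 → Fin 3 → Bool,
    ∀ a : Fin 3 → Bool, (∀ i, (∃ k, u i k ∧ a k) ↔ i ≠ 0) →
    ∀ b : Fin 3 → Bool, (∀ i, (∃ k, u i k ∧ b k) ↔ i ≠ 1) →
    ∀ c : Fin 3 → Bool, (∀ i, (∃ k, u i k ∧ c k) ↔ i ≠ 2) →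
    (∃ σ : Equiv.Perm (Fin 3), ∀ i j, u i j ↔ j = σ i) ∨
    ∃ σ : Equiv.Perm (Fin 3), ∀ i, (a i ↔ 0 = σ i) ∧ (b i ↔ 1 = σ i) ∧ (c i ↔ 2 = σ i) := by
  decide +kernel

theorem isPrimeElement_matX (n : ℕ) : IsPrimeElement (matX n) := by
  refine ⟨not_isUnit_matX n, fun U V h => ?_⟩
  have hUV : ¬ (IsUnit U ∧ IsUnit V) := fun ⟨hU, hV⟩ => not_isUnit_matX n (h ▸ hU.mul hV)
  have hsupp : ∀ i j, (∃ k, U i k ≠ 0 ∧ V k j ≠ 0) ↔ i ≠ j := fun i j => by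
    rw [← mul_apply_ne_zero, ← h, matX_apply_ne_zero]
  have hor : IsUnit U ∨ IsUnit V := by
    simp only [isUnit_iff_isMonomial]
    have := bool_hollow_factor (fun i k => decide (U i k ≠ 0))
      (fun k => decide (V k 0 ≠ 0)) (fun i => by simpa using hsupp i 0)
      (fun k => decide (V k 1 ≠ 0)) (fun i => by simpa using hsupp i 1)
      (fun k => decide (V k 2 ≠ 0)) (fun i => by simpa using hsupp i 2)
    simp only [decide_eq_true_eq] at this
    refine this.imp id fun ⟨σ, hσ⟩ => ⟨σ, fun i j => ?_⟩
    fin_cases j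
    exacts [(hσ i).1, (hσ i).2.1, (hσ i).2.2]
  tauto

/-- The weight of a permutation in a matrix: the product of the entries at its positions, that is,
the corresponding term of the tropical permanent. -/
def permWeight (M : M3) (π : Equiv.Perm (Fin 3)) : ZMax := ∏ i, M i (π i)

/-- Multiplication by units permutes the weights and shifts them by a common integer. -/
theorem exists_permWeight_eq (u v : M3ˣ) (M : M3) : ∃ c : ℤ, ∀ π, ∃ π',
    permWeight (u * M * v) π = int c * permWeight M π' := by
  obtain ⟨d, σ, hu⟩ := (isUnit_iff_isMonomial.1 u.isUnit).exists_eq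
  obtain ⟨e, τ, hv⟩ := (isUnit_iff_isMonomial.1 v.isUnit).exists_eq
  have hprod : ∀ f : Fin 3 → ℤ, ∏ i, int (f i) = int (∑ i, f i) := fun f => by
    simp [Fin.prod_univ_three, Fin.sum_univ_three]
  refine ⟨∑ i, d i + ∑ i, e i, fun π => ⟨τ⁻¹ * π * σ⁻¹, ?_⟩⟩
  have hentry : ∀ i, (u * M * v : M3) i (π i) =
      int (d i) * (M (σ i) ((τ⁻¹ * π * σ⁻¹) (σ i)) * int (e ((τ⁻¹ * π) i))) := fun i => by
    rw [hu, hv, ← mul_assoc, mul_permMatrix_apply, Matrix.mul_diagonal, mul_assoc (diagonal _),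
      Matrix.diagonal_mul, permMatrix_mul_apply, mul_assoc]
    simp
  simp only [permWeight, hentry, Finset.prod_mul_distrib]
  rw [Equiv.prod_comp σ fun i => M i ((τ⁻¹ * π * σ⁻¹) i),
    Equiv.prod_comp (τ⁻¹ * π) fun i => int (e i), hprod, hprod, ← int_mul_int]
  ring

theorem permWeight_matX (n : ℕ) (π : Equiv.Perm (Fin 3)) :
    permWeight (matX n) π = 0 ∨ permWeight (matX n) π = int 0 ∨ permWeight (matX n) π = int n := by
  have h : ∀ π : Equiv.Perm (Fin 3), (∃ i, π i = i) ∨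
      (π 0 = 1 ∧ π 1 = 2 ∧ π 2 = 0) ∨ (π 0 = 2 ∧ π 1 = 0 ∧ π 2 = 1) := by decide +kernel
  rcases h π with ⟨i, hi⟩ | ⟨h0, h1, h2⟩ | ⟨h0, h1, h2⟩
  · left
    refine Finset.prod_eq_zero (Finset.mem_univ i) ?_
    rw [hi]
    simpa using (matX_apply_ne_zero n i i).not
  · right; left
    simp [permWeight, Fin.prod_univ_three, h0, h1, h2, matX]
  · right; right
    simp [permWeight, Fin.prod_univ_three, h0, h1, h2, matX]

/-- The finite weights `0`, `n` of `matX n` are a common shift away from those of `matX m`, which are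
`0` and `m`. -/
theorem eq_zero_or_eq_of_matX_associated {m n : ℕ} {u v : M3ˣ} (h : matX m = u * matX n * v) :
    m = 0 ∨ m = n := by
  obtain ⟨c, hc⟩ := exists_permWeight_eq u v (matX n)
  rw [← h] at hc
  have h0 : permWeight (matX m) (finRotate 3) = int 0 := by
    simp [permWeight, Fin.prod_univ_three, matX]
  have hm : permWeight (matX m) (finRotate 3)⁻¹ = int m := by
    simp [permWeight, Fin.prod_univ_three, matX]
  obtain ⟨π₀, hπ₀⟩ := hc (finRotate 3)
  obtain ⟨π₁, hπ₁⟩ := hc (finRotate 3)⁻¹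
  rw [h0] at hπ₀
  rw [hm] at hπ₁
  rcases permWeight_matX n π₀ with e₀ | e₀ | e₀ <;>
    rcases permWeight_matX n π₁ with e₁ | e₁ | e₁ <;>
    rw [e₀] at hπ₀ <;> rw [e₁] at hπ₁ <;> simp at hπ₀ hπ₁ <;> omega

theorem eq_of_matX_associated {m n : ℕ} {u v : M3ˣ} (h : matX m = u * matX n * v) : m = n := by
  have h' : matX n = ↑u⁻¹ * matX m * ↑v⁻¹ := by simp [h, mul_assoc]
  have h1 := eq_zero_or_eq_of_matX_associated h
  have h2 := eq_zero_or_eq_of_matX_associated h'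
  omega

theorem countable_generators : generators.Countable :=
  (Set.toFinite _).countable.union (Set.countable_range _)

theorem isMinimalGenSet_generators : IsMinimalGenSet generators := by
  refine ⟨isGenSet_generators, fun Y hY => ?_⟩
  choose y hyY u v h using fun n => (isPrimeElement_matX n).exists_eq_of_mem_closure (Y := Y)
    (by rw [show Subsemigroup.closure Y = ⊤ from hY]; exact Subsemigroup.mem_top _)
  have hinj : Function.Injective fun n => (⟨y n, hyY n⟩ : Y) := fun m n hmn => by
    have hmn : y m = y n := congrArg Subtype.val hmn
    refine eq_of_matX_associated (u := u m * (u n)⁻¹) (v := (v n)⁻¹ * v m) ?_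
    rw [h n, h m, hmn]
    simp [mul_assoc]
  have : Infinite Y := Infinite.of_injective _ hinj
  exact (Cardinal.mk_le_aleph0_iff.2 countable_generators.to_subtype).trans
    (Cardinal.aleph0_le_mk Y)

/-! ### Irredundance -/

theorem isUnit_diagAt_int {n : ℕ} (i : Fin n) (a : ℤ) : IsUnit (diagAt i (int a)) :=
  IsUnit.of_mul_eq_one (diagAt i (int (-a)))
    (by rw [diagAt_mul, int_mul_int, add_neg_cancel, ← one_eq, diagAt_one])

theorem isUnit_matA : IsUnit matA := (isUnit_diagAt_int _ _).mul (isUnit_permMatrix _)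

theorem isUnit_matB : IsUnit matB := (isUnit_diagAt_int _ _).mul (isUnit_permMatrix _)

theorem not_isUnit_matE : ¬ IsUnit matE := fun h => by
  have := (isUnit_iff_isMonomial.1 h).eq_of_ne_zero (i := 0) (j := 0) (k := 1)
    (by decide +kernel) (by decide +kernel)
  exact absurd this (by decide)

theorem matC_zero_apply : ∀ j, matC 0 j = 0 := by decide +kernel

theorem not_isUnit_matC : ¬ IsUnit matC := fun h => by
  obtain ⟨σ, hσ⟩ := isUnit_iff_isMonomial.1 h
  exact (hσ 0 _).2 rfl (matC_zero_apply _)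

theorem generators_cases {y : M3} (hy : y ∈ generators) :
    y = matA ∨ y = matB ∨ y = matE ∨ y = matC ∨ ∃ n, y = matX n := by
  rcases hy with hy | ⟨n, rfl⟩
  · rcases hy with h | h | h | h
    exacts [.inl h, .inr (.inl h), .inr (.inr (.inl h)), .inr (.inr (.inr (.inl h)))]
  · exact .inr (.inr (.inr (.inr ⟨n, rfl⟩)))

/-- If all units of `Y` are equal to `b`, then the units generated by `Y` are powers of `b`, and
hence commute with `b`. -/
theorem commute_of_mem_closure {M : Type*} [Monoid M] [IsDedekindFiniteMonoid M] {Y : Set M}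
    {b x : M} (hY : ∀ y ∈ Y, IsUnit y → y = b) (hx : x ∈ Subsemigroup.closure Y)
    (hu : IsUnit x) : Commute x b := by
  induction hx using Subsemigroup.closure_induction with
  | mem x hx => rw [hY x hx hu]
  | mul z w _ _ ihz ihw =>
    rw [IsUnit.mul_iff] at hu
    exact (ihz hu.1).mul_left (ihw hu.2)

theorem not_isGenSet_diff_of_not_commute {a b : M3}
    (hab : ∀ y ∈ generators, IsUnit y → y ≠ a → y = b)
    (ha : IsUnit a) (hcomm : a * b ≠ b * a) : ¬ IsGenSet (generators \ {a}) := fun h =>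
  hcomm (commute_of_mem_closure (Y := generators \ {a}) (fun y hy hu => hab y hy.1 hu hy.2)
    (by rw [show Subsemigroup.closure _ = ⊤ from h]; exact Subsemigroup.mem_top _) ha)

theorem eq_or_eq_of_isUnit {y : M3} (hy : y ∈ generators) (hu : IsUnit y) :
    y = matA ∨ y = matB := by
  rcases generators_cases hy with rfl | rfl | rfl | rfl | ⟨n, rfl⟩
  exacts [.inl rfl, .inr rfl, absurd hu not_isUnit_matE, absurd hu not_isUnit_matC,
    absurd hu (not_isUnit_matX n)]

/-- Exactly one permutation lies in the support of the matrix: up to permuting rows and columns, the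
matrix is triangular without zeros on the diagonal. -/
def HasUniquePerm {ι : Type*} (M : Matrix ι ι ZMax) : Prop :=
  ∃! π : Equiv.Perm ι, ∀ i, M i (π i) ≠ 0

/-- If the support of a product contains exactly one permutation, then so does the support of each
factor. -/
theorem HasUniquePerm.of_mul {ι : Type*} [Fintype ι] [DecidableEq ι] {M N : Matrix ι ι ZMax}
    (h : HasUniquePerm (M * N)) : HasUniquePerm M ∧ HasUniquePerm N := by
  obtain ⟨π, hπ, huniq⟩ := h
  choose f hM hN using fun i => mul_apply_ne_zero.1 (hπ i)
  -- If `f` identified `i` and `j`, exchanging `π i` and `π j` would give a second permutation.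
  have hf : Function.Injective f := fun i j hij => by
    have hsw : ∀ k, (M * N) k ((π * Equiv.swap i j) k) ≠ 0 := fun k => by
      refine mul_apply_ne_zero.2 ⟨f k, hM k, ?_⟩
      rw [Equiv.Perm.mul_apply]
      rcases eq_or_ne k i with rfl | hki
      · rw [Equiv.swap_apply_left, hij]; exact hN j
      rcases eq_or_ne k j with rfl | hkj
      · rw [Equiv.swap_apply_right, ← hij]; exact hN i
      · rw [Equiv.swap_apply_of_ne_of_ne hki hkj]; exact hN k
    have := huniq _ hsw
    rw [mul_eq_left, Equiv.swap_eq_one_iff] at this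
    exact this
  obtain ⟨φ, hφ⟩ : ∃ φ : Equiv.Perm ι, ∀ i, φ i = f i :=
    ⟨Equiv.ofBijective f (Finite.injective_iff_bijective.1 hf), fun _ => rfl⟩
  have hφs : ∀ k, f (φ⁻¹ k) = k := fun k => (hφ _).symm.trans (φ.apply_symm_apply k)
  refine ⟨⟨φ, fun i => hφ i ▸ hM i, fun ψ hψ => ?_⟩,
    ⟨π * φ⁻¹, fun i => ?_, fun ψ hψ => ?_⟩⟩
  · have : π * φ⁻¹ * ψ = π := huniq _ fun i => mul_apply_ne_zero.2 ⟨ψ i, hψ i, by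
      have := hN (φ⁻¹ (ψ i))
      rwa [hφs] at this⟩
    rw [mul_assoc, mul_eq_left, inv_mul_eq_one] at this
    exact this.symm
  · have := hN (φ⁻¹ i)
    rwa [hφs] at this
  · have : ψ * φ = π := huniq _ fun i => mul_apply_ne_zero.2 ⟨f i, hM i, by
      rw [Equiv.Perm.mul_apply, hφ]; exact hψ (f i)⟩
    rw [← this, mul_inv_cancel_right]

/-- A nonunit whose support contains exactly one permutation can only be generated with the help of
another such matrix. -/
theorem exists_hasUniquePerm_of_mem_closure {Y : Set M3} {M : M3} (hM : M ∈ Subsemigroup.closure Y)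
    (h : HasUniquePerm M) (hu : ¬ IsUnit M) : ∃ y ∈ Y, HasUniquePerm y ∧ ¬ IsUnit y := by
  induction hM using Subsemigroup.closure_induction with
  | mem x hx => exact ⟨x, hx, h, hu⟩
  | mul z w _ _ ihz ihw =>
    rw [IsUnit.mul_iff, not_and_or] at hu
    exact hu.elim (ihz h.of_mul.1) (ihw h.of_mul.2)

theorem hasUniquePerm_matE : HasUniquePerm matE := by
  have h : ∀ π : Equiv.Perm (Fin 3), (∀ i, matE i (π i) ≠ 0) ↔ π = 1 := by decide +kernel
  exact ⟨1, (h 1).2 rfl, fun π hπ => (h π).1 hπ⟩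

theorem not_hasUniquePerm_matC : ¬ HasUniquePerm matC := fun ⟨_, hπ, _⟩ =>
  hπ 0 (matC_zero_apply _)

theorem not_hasUniquePerm_matX (n : ℕ) : ¬ HasUniquePerm (matX n) := fun h => by
  simp only [HasUniquePerm, matX_apply_ne_zero] at h
  have h2 := h.unique (y₁ := finRotate 3) (y₂ := (finRotate 3)⁻¹) (by decide) (by decide)
  exact absurd h2 (by decide)

theorem not_isGenSet_diff_matE : ¬ IsGenSet (generators \ {matE}) := fun h => by
  obtain ⟨y, ⟨hy, hne⟩, hperm, hu⟩ := exists_hasUniquePerm_of_mem_closure (M := matE)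
    (by rw [show Subsemigroup.closure _ = ⊤ from h]; exact Subsemigroup.mem_top _)
    hasUniquePerm_matE not_isUnit_matE
  rcases generators_cases hy with rfl | rfl | rfl | rfl | ⟨n, rfl⟩
  exacts [hu isUnit_matA, hu isUnit_matB, hne rfl, not_hasUniquePerm_matC hperm,
    not_hasUniquePerm_matX n hperm]

/-- Matrices without a zero row are closed under products. -/
theorem exists_ne_zero_of_mem_closure {Y : Set M3} (hY : ∀ y ∈ Y, ∀ i, ∃ j, y i j ≠ 0) {M : M3}
    (hM : M ∈ Subsemigroup.closure Y) : ∀ i, ∃ j, M i j ≠ 0 := by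
  induction hM using Subsemigroup.closure_induction with
  | mem x hx => exact hY x hx
  | mul z w _ _ ihz ihw =>
    intro i
    obtain ⟨k, hk⟩ := ihz i
    obtain ⟨j, hj⟩ := ihw k
    exact ⟨j, mul_apply_ne_zero.2 ⟨k, hk, hj⟩⟩

theorem not_isGenSet_diff_matC : ¬ IsGenSet (generators \ {matC}) := fun h => by
  have hY : ∀ y ∈ generators \ {matC}, ∀ i, ∃ j, y i j ≠ 0 := fun y ⟨hy, hne⟩ => by
    rcases generators_cases hy with rfl | rfl | rfl | rfl | ⟨n, rfl⟩
    · obtain ⟨σ, hσ⟩ := isUnit_iff_isMonomial.1 isUnit_matA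
      exact fun i => ⟨σ i, (hσ i _).2 rfl⟩
    · obtain ⟨σ, hσ⟩ := isUnit_iff_isMonomial.1 isUnit_matB
      exact fun i => ⟨σ i, (hσ i _).2 rfl⟩
    · exact fun i => ⟨i, by revert i; decide +kernel⟩
    · exact absurd rfl hne
    · simp only [matX_apply_ne_zero]
      decide
  obtain ⟨j, hj⟩ := exists_ne_zero_of_mem_closure hY (M := matC)
    (by rw [show Subsemigroup.closure _ = ⊤ from h]; exact Subsemigroup.mem_top _) 0
  exact hj (matC_zero_apply j)

theorem not_isGenSet_diff_matX (n : ℕ) : ¬ IsGenSet (generators \ {matX n}) := fun h => by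
  obtain ⟨y, ⟨hy, hne⟩, u, v, huv⟩ := (isPrimeElement_matX n).exists_eq_of_mem_closure
    (Y := generators \ {matX n})
    (by rw [show Subsemigroup.closure _ = ⊤ from h]; exact Subsemigroup.mem_top _)
  have hprime : IsPrimeElement y :=
    ((huv ▸ isPrimeElement_matX n).of_mul_isUnit v.isUnit).of_isUnit_mul u.isUnit
  rcases generators_cases hy with rfl | rfl | rfl | rfl | ⟨m, rfl⟩
  · exact hprime.1 isUnit_matA
  · exact hprime.1 isUnit_matB
  · exact not_isPrimeElement_of_isIdempotentElem (by unfold IsIdempotentElem; decide +kernel) hprime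
  · exact not_isPrimeElement_of_isIdempotentElem (by unfold IsIdempotentElem; decide +kernel) hprime
  · exact hne (by rw [eq_of_matX_associated huv]; rfl)

theorem isIrredundantGenSet_generators : IsIrredundantGenSet generators := by
  refine ⟨isGenSet_generators, fun x hx => ?_⟩
  rcases generators_cases hx with rfl | rfl | rfl | rfl | ⟨n, rfl⟩
  · exact not_isGenSet_diff_of_not_commute (b := matB)
      (fun y hy hu hne => (eq_or_eq_of_isUnit hy hu).resolve_left hne) isUnit_matA
      (by decide +kernel)
  · exact not_isGenSet_diff_of_not_commute (b := matA)
      (fun y hy hu hne => (eq_or_eq_of_isUnit hy hu).resolve_right hne) isUnit_matB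
      (by decide +kernel)
  · exact not_isGenSet_diff_matE
  · exact not_isGenSet_diff_matC
  · exact not_isGenSet_diff_matX n

end TropicalGen

theorem mainTheorem1 :
    TropicalGen.IsMinimalGenSet TropicalGen.generators ∧
      TropicalGen.IsIrredundantGenSet TropicalGen.generators ∧
      TropicalGen.generators.Countable ∧
      ∀ i : ℕ, TropicalGen.IsPrimeElement (TropicalGen.matX i) :=
  ⟨TropicalGen.isMinimalGenSet_generators, TropicalGen.isIrredundantGenSet_generators,
    TropicalGen.countable_generators, TropicalGen.isPrimeElement_matX⟩
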